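/- Let $k\ge 2$, let $a_1,\dots,a_k\ge 1$ be integers, let $F=\bigcup_{i=1}^k P_{2a_i}$ be the disjoint union of the paths $P_{2a_i}$ (where $P_m$ is the path on $m$ vertices), and let $h=\sum_{i=1}^k a_i-1$ (so $h\ge 1$). Let $G$ be a finite simple connected graph on $n\ge 2h+2$ vertices with minimum degree $\delta(G)\ge h$. Then $G$ contains $F$ as a (not necessarily induced) subgraph, unless at least one of the following holds: (i) $G$ is isomorphic to a subgraph of $S_{n,h}:=K_h\vee\overline{K}_{n-h}$, the join of a complete graph on $h$ vertices and an edgeless graph on $n-h$ vertices; (ii) $F$ is the disjoint union of two paths of the same order, i.e. $F=2P_{2a_1}$ ($k=2$, $a_1=a_2$), and, for some integer $t$ with $n=th+1$, $G$ is isomorphic to $L_{t,h}:=K_1\vee tK_h$, the graph consisting of $t$ copies of $K_{h+1}$ that share exactly one common vertex. -/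

import Mathlib

namespace LinearForest

open SimpleGraph

/-- The disjoint union of a family of graphs. -/
def disjUnion {ι : Type*} {V : ι → Type*} (G : ∀ i, SimpleGraph (V i)) :
    SimpleGraph (Σ i, V i) where
  Adj x y := ∃ (i : ι) (u v : V i), (G i).Adj u v ∧ x = ⟨i, u⟩ ∧ y = ⟨i, v⟩
  symm.symm := by
    rintro x y ⟨i, u, v, h, hx, hy⟩
    exact ⟨i, v, u, h.symm, hy, hx⟩
  loopless.irrefl := by
    rintro x ⟨i, u, v, h, hx, hy⟩
    rw [hx] at hy
    exact h.ne (eq_of_heq (Sigma.mk.inj hy).2)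

/-- `t` disjoint copies of the graph `G`. -/
def copies (t : ℕ) {V : Type*} (G : SimpleGraph V) : SimpleGraph (Σ _ : Fin t, V) :=
  disjUnion fun _ : Fin t => G

/-- The join of two graphs: their disjoint union together with all edges between them. -/
def join {V W : Type*} (G : SimpleGraph V) (H : SimpleGraph W) : SimpleGraph (V ⊕ W) :=
  (G ⊕g H) ⊔ completeBipartiteGraph V W

/-- The disjoint union of the paths of orders `2 * a 0, …, 2 * a (k - 1)`. -/
def evenLinearForest {k : ℕ} (a : Fin k → ℕ) : SimpleGraph (Σ i, Fin (2 * a i)) :=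
  disjUnion fun i => pathGraph (2 * a i)

/-- The join of a complete graph of order `h` and an edgeless graph of order `n - h`
(used for `h ≤ n`). -/
def graphS (n h : ℕ) : SimpleGraph (Fin h ⊕ Fin (n - h)) :=
  join (completeGraph (Fin h)) (emptyGraph (Fin (n - h)))

/-- The join of a single vertex and `t` disjoint copies of the complete graph of order `h`, that is,
`t` copies of the complete graph of order `h + 1` sharing exactly one vertex. -/
def graphL (t h : ℕ) : SimpleGraph (Fin 1 ⊕ (Σ _ : Fin t, Fin h)) :=
  join (completeGraph (Fin 1)) (copies t (completeGraph (Fin h)))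

end LinearForest

namespace LinearForest

/-! ### Paths and cycles as vertex lists -/

variable {V : Type*} {G : SimpleGraph V}

/-! If `G` does not contain the forest, no path has `2h + 2` vertices, since such a path could be
cut into the required pieces. In a connected graph a cycle that misses a vertex opens into a path
with one more vertex, so cycles on `2h + 1` vertices are excluded too. What remains depends on
cycles on `2h` vertices.

Suppose one exists. A vertex off it has all its neighbours on it, no two consecutive, and at least
`h` of them, so it sees every second vertex. All outside vertices see the same `h` vertices, and
exchanging cycle vertices for outside ones shows that these cover all edges
(`IsCycleList.exists_cover`); thus `G` lies in `S_{n,h}`.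

Suppose none exists. A crossing argument in the style of Dirac and Pósa (`IsPathList.dichotomy`)
produces a path on `2h + 1` vertices and shows that the first vertex of any such path is adjacent to
exactly the next `h`. Reversing initial segments turns the first `h` vertices into a clique attached
to the rest only at the middle vertex `c`. Connectivity puts every other vertex in such a block, so
`G` is `L_{t,h}`. There are at least three blocks: two joined through `c` carry a path on `2h + 1`
vertices, and the third is free for a component of order at most `h`. So all components have order
greater than `h`, which leaves two equal ones. -/

/-- A list of distinct vertices, consecutive ones being adjacent. -/
structure IsPathList (G : SimpleGraph V) (l : List V) : Prop where
  chain : l.IsChain G.Adj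
  nodup : l.Nodup

/-- A path list whose last vertex is adjacent to its first one; lists of length two are allowed. -/
structure IsCycleList (G : SimpleGraph V) (l : List V) : Prop extends IsPathList G l where
  closed : ∀ x ∈ l.getLast?, ∀ y ∈ l.head?, G.Adj x y

lemma IsPathList.reverse {l : List V} (hl : IsPathList G l) : IsPathList G l.reverse :=
  ⟨by
    rw [List.isChain_reverse]
    exact hl.chain.imp fun _ _ h => h.symm, List.nodup_reverse.2 hl.nodup⟩

lemma IsPathList.append {s t : List V} (hs : IsPathList G s) (ht : IsPathList G t)
    (hst : s.Disjoint t) (h : ∀ x ∈ s.getLast?, ∀ y ∈ t.head?, G.Adj x y) :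
    IsPathList G (s ++ t) :=
  ⟨List.isChain_append.2 ⟨hs.chain, ht.chain, h⟩, List.nodup_append'.2 ⟨hs.nodup, ht.nodup, hst⟩⟩

lemma IsPathList.left {s t : List V} (h : IsPathList G (s ++ t)) : IsPathList G s :=
  ⟨(List.isChain_append.1 h.chain).1, (List.nodup_append'.1 h.nodup).1⟩

lemma IsPathList.right {s t : List V} (h : IsPathList G (s ++ t)) : IsPathList G t :=
  ⟨(List.isChain_append.1 h.chain).2.1, (List.nodup_append'.1 h.nodup).2.1⟩

lemma IsPathList.disjoint {s t : List V} (h : IsPathList G (s ++ t)) : s.Disjoint t :=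
  (List.nodup_append'.1 h.nodup).2.2

lemma IsPathList.adj {s t : List V} (h : IsPathList G (s ++ t)) :
    ∀ x ∈ s.getLast?, ∀ y ∈ t.head?, G.Adj x y :=
  (List.isChain_append.1 h.chain).2.2

lemma IsPathList.cons {x y : V} {t : List V} (h : IsPathList G (y :: t)) (hx : x ∉ y :: t)
    (hxy : G.Adj x y) : IsPathList G (x :: y :: t) :=
  ⟨List.isChain_cons_cons.2 ⟨hxy, h.chain⟩, List.nodup_cons.2 ⟨hx, h.nodup⟩⟩

lemma IsCycleList.rotate {s t : List V} (h : IsCycleList G (s ++ t)) : IsCycleList G (t ++ s) := by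
  rcases List.eq_nil_or_concat s with rfl | ⟨s', a, rfl⟩
  · simpa using h
  rcases t with _ | ⟨b, t⟩
  · simpa using h
  rw [List.concat_eq_append] at h ⊢
  refine ⟨h.right.append h.left h.disjoint.symm fun x hx y hy => h.closed x ?_ y ?_, ?_⟩
  · simpa [List.getLast?_append] using hx
  · cases s' <;> simpa using hy
  · intro x hx y hy
    rw [← List.append_assoc, List.getLast?_concat] at hx
    exact h.adj x (by simpa using hx) y (by simpa using hy)

lemma IsCycleList.exists_cons {l : List V} (h : IsCycleList G l) {x : V} (hx : x ∈ l) :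
    ∃ t, IsCycleList G (x :: t) ∧ (x :: t).Perm l := by
  obtain ⟨s, t, rfl⟩ := List.append_of_mem hx
  exact ⟨t ++ s, by simpa using h.rotate, by simpa using List.perm_append_comm (l₁ := x :: t)⟩

/-- Two vertices off a cycle attached at consecutive vertices of the cycle. -/
lemma IsCycleList.insert_path {x y u w : V} {t : List V} (h : IsCycleList G (x :: y :: t))
    (hu : u ∉ x :: y :: t) (hw : w ∉ x :: y :: t) (huw : u ≠ w) (hux : G.Adj u x)
    (hwy : G.Adj w y) : IsPathList G (w :: (y :: t ++ [x, u])) := by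
  have h1 : IsPathList G (y :: t ++ [x]) := (h.rotate (s := [x])).toIsPathList
  have h2 : IsPathList G ((y :: t ++ [x]) ++ [u]) := by
    refine h1.append ⟨by simp, by simp⟩ ?_ ?_
    · simp at hu ⊢; tauto
    · simpa [List.getLast?_append, List.getLast?_cons] using hux.symm
  have h3 := IsPathList.cons (x := w) (y := y) (t := t ++ [x] ++ [u]) (by simpa using h2)
    (by simp at hw ⊢; tauto) hwy
  simpa using h3

/-- Inserting a vertex between two consecutive vertices of a cycle. -/
lemma IsCycleList.insert {x y w : V} {t : List V} (h : IsCycleList G (x :: y :: t))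
    (hw : w ∉ x :: y :: t) (hx : G.Adj w x) (hy : G.Adj w y) :
    IsCycleList G (w :: (y :: t ++ [x])) := by
  have h1 := h.rotate (s := [x])
  refine ⟨IsPathList.cons (by simpa using h1.toIsPathList) (by simp at hw ⊢; tauto) hy, ?_⟩
  intro a ha b hb
  have : a = x := by
    rw [show w :: (y :: t ++ [x]) = (w :: y :: t) ++ [x] by simp, List.getLast?_concat] at ha
    simpa using ha.symm
  have hwb : w = b := by simpa using hb
  subst this hwb
  exact hx.symm

lemma mem_of_closed (hconn : G.Connected) {S : Set V} {x : V} (hx : x ∈ S)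
    (hS : ∀ a ∈ S, ∀ b, G.Adj a b → b ∈ S) (y : V) : y ∈ S := by
  obtain ⟨p⟩ := hconn.preconnected x y
  induction p with
  | nil => exact hx
  | cons h _ ih => exact ih (hS _ hx _ h)

lemma length_lt_exists_notMem [Fintype V] {l : List V} (h : l.length < Fintype.card V) :
    ∃ x, x ∉ l := by
  classical
  by_contra! hl
  have : (Finset.univ : Finset V) ⊆ l.toFinset := fun x _ => by simpa using hl x
  have := (Finset.card_le_card this).trans l.toFinset_card_le
  simp at this
  omega

/-- By connectivity some edge leaves the cycle; open the cycle at its endpoint. -/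
lemma IsCycleList.exists_longer [Fintype V] (hconn : G.Connected) {l : List V}
    (h : IsCycleList G l) (hl : l ≠ []) (hcard : l.length < Fintype.card V) :
    ∃ l', IsPathList G l' ∧ l'.length = l.length + 1 := by
  by_contra! hno
  obtain ⟨x, hx⟩ := List.exists_mem_of_ne_nil l hl
  obtain ⟨w, hw⟩ := length_lt_exists_notMem hcard
  refine hw (mem_of_closed hconn (S := {v | v ∈ l}) hx (fun a ha b hab => ?_) w)
  by_contra hb
  obtain ⟨t, ht, hp⟩ := h.exists_cons ha
  exact hno (b :: a :: t) (ht.toIsPathList.cons (fun hm => hb (hp.mem_iff.1 hm)) hab.symm)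
    (by simpa using hp.length_eq)

lemma two_mul_countP_le {p : V → Bool} :
    ∀ {l : List V}, l.IsChain (fun x y => ¬(p x = true ∧ p y = true)) →
      2 * l.countP p ≤ l.length + 1
  | [], _ => by simp
  | [x], _ => by
    have := List.countP_le_length (p := p) (l := [x])
    rw [List.length_singleton] at this ⊢; omega
  | x :: y :: l, h => by
    rw [List.isChain_cons_cons] at h
    have ih := two_mul_countP_le (p := p) (l := l) h.2.tail
    simp only [List.countP_cons, List.length_cons]
    have := h.1
    by_cases hx : p x = true <;> by_cases hy : p y = true <;> simp [hx, hy] at this ⊢ <;> omega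

/-! ### Vertices off a cycle of length `2 * h`, and the vertex cover -/

section Finite

variable {h : ℕ}

lemma degree_le_countP [Fintype V] [DecidableRel G.Adj] {l : List V} {w : V} (hw : ∀ y, G.Adj w y → y ∈ l) :
    G.degree w ≤ l.countP (fun y => decide (G.Adj w y)) := by
  classical
  rw [← SimpleGraph.card_neighborFinset_eq_degree, List.countP_eq_length_filter]
  refine le_trans (Finset.card_le_card (t := (l.filter fun y => decide (G.Adj w y)).toFinset) ?_)
    (List.toFinset_card_le _)
  intro y hy
  have hy : G.Adj w y := by simpa using hy
  simp [hy, hw y hy]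

section Cycle

variable {C : List V}

/-- An edge off the cycle with one end attached to it would extend the opened cycle to `2h + 2`
vertices. Hence no vertex is at distance two from the cycle. -/
lemma IsCycleList.neighbors_mem (hconn : G.Connected)
    (hpath : ∀ l, IsPathList G l → l.length ≤ 2 * h + 1) (h0 : 1 ≤ h)
    (hC : IsCycleList G C) (hlen : C.length = 2 * h) {w : V} (hw : w ∉ C) :
    ∀ y, G.Adj w y → y ∈ C := by
  have key : ∀ d ∉ C, (∃ x ∈ C, G.Adj d x) → ∀ y, G.Adj d y → y ∈ C := by
    rintro d hd ⟨x, hx, hdx⟩ y hdy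
    by_contra hy
    obtain ⟨t, ht, hp⟩ := hC.exists_cons hx
    have hl := hp.length_eq
    have h1 := ht.toIsPathList.cons (fun hm => hd (hp.mem_iff.1 hm)) hdx
    have h2 := hpath _ (h1.cons (x := y) (fun hm => by
      rcases List.mem_cons.1 hm with rfl | hm
      · exact hdy.ne rfl
      · exact hy (hp.mem_iff.1 hm)) hdy.symm)
    simp only [List.length_cons] at h2 hl
    omega
  obtain ⟨x, hx⟩ := List.exists_mem_of_length_pos (l := C) (by omega)
  have := mem_of_closed hconn (S := {v | v ∈ C ∨ ∃ x ∈ C, G.Adj v x}) (Or.inl hx) (by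
    rintro a ha b hab
    by_cases haC : a ∈ C
    · exact Or.inr ⟨a, haC, hab.symm⟩
    · exact Or.inl (key a haC (ha.resolve_left haC) b hab)) w
  exact key w hw (this.resolve_left hw)

variable [Fintype V]

/-- Otherwise `w` could be inserted, and the resulting cycle on `2h + 1` vertices opens into a path
that is too long. -/
lemma IsCycleList.not_adj_both (hconn : G.Connected) (hcard : 2 * h + 2 ≤ Fintype.card V)
    (hpath : ∀ l, IsPathList G l → l.length ≤ 2 * h + 1) {x y w : V} {t : List V}
    (hC : IsCycleList G (x :: y :: t)) (hlen : (x :: y :: t).length = 2 * h)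
    (hw : w ∉ x :: y :: t) : ¬(G.Adj w x ∧ G.Adj w y) := by
  rintro ⟨hx, hy⟩
  have hl : (w :: (y :: t ++ [x])).length = 2 * h + 1 := by
    simp only [List.length_cons, List.length_append, List.length_nil] at hlen ⊢
    omega
  obtain ⟨l, hl1, hl2⟩ := (hC.insert hw hx hy).exists_longer hconn (by simp) (by omega)
  have := hpath l hl1
  omega

variable [DecidableRel G.Adj]

lemma IsCycleList.two_mul_countP_adj_le (hconn : G.Connected)
    (hcard : 2 * h + 2 ≤ Fintype.card V)
    (hpath : ∀ l, IsPathList G l → l.length ≤ 2 * h + 1) {s t : List V}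
    (hC : IsCycleList G (s ++ t)) (hlen : (s ++ t).length = 2 * h) {w : V} (hw : w ∉ s ++ t) :
    2 * t.countP (fun y => decide (G.Adj w y)) ≤ t.length + 1 := by
  refine two_mul_countP_le (List.isChain_iff_forall_rel_of_append_cons_cons.2 ?_)
  rintro a b l₁ l₂ rfl
  have h1 : IsCycleList G (a :: b :: (l₂ ++ (s ++ l₁))) := by
    simpa using IsCycleList.rotate (s := s ++ l₁) (t := a :: b :: l₂) (by simpa using hC)
  have h2 := h1.not_adj_both (w := w) hconn hcard hpath
    (by simp only [List.length_append, List.length_cons] at hlen ⊢; omega)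
    (by simp at hw ⊢; tauto)
  simpa using h2

/-- If `w` missed two consecutive vertices, its neighbours would lie among the other `2h - 2`, no
two consecutive, so there would be at most `h - 1` of them. -/
lemma IsCycleList.alternates (hconn : G.Connected) (hdeg : ∀ v, h ≤ G.degree v)
    (hcard : 2 * h + 2 ≤ Fintype.card V)
    (hpath : ∀ l, IsPathList G l → l.length ≤ 2 * h + 1) (h0 : 1 ≤ h) {x y w : V} {t : List V}
    (hC : IsCycleList G (x :: y :: t)) (hlen : (x :: y :: t).length = 2 * h)
    (hw : w ∉ x :: y :: t) : G.Adj w x ↔ ¬G.Adj w y := by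
  refine ⟨fun hx hy => hC.not_adj_both hconn hcard hpath hlen hw ⟨hx, hy⟩, fun hy => ?_⟩
  by_contra hx
  have h1 : G.degree w ≤ t.countP (fun y => decide (G.Adj w y)) := by
    refine degree_le_countP fun z hz => ?_
    have := hC.neighbors_mem hconn hpath h0 hlen hw z hz
    simp only [List.mem_cons] at this
    rcases this with rfl | rfl | h
    · exact absurd hz hx
    · exact absurd hz hy
    · exact h
  have h2 := IsCycleList.two_mul_countP_adj_le (s := [x, y]) hconn hcard hpath hC hlen hw
  have := hdeg w
  simp only [List.length_cons] at hlen
  omega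

/-- If `w` misses `x`, it sees the successor `y` of `x`; going from `w` to `y`, around the cycle to
`x` and out to `u` uses `2h + 2` vertices. -/
lemma IsCycleList.adj_of_adj (hconn : G.Connected) (hdeg : ∀ v, h ≤ G.degree v)
    (hcard : 2 * h + 2 ≤ Fintype.card V)
    (hpath : ∀ l, IsPathList G l → l.length ≤ 2 * h + 1) (h0 : 1 ≤ h)
    (hC : IsCycleList G C) (hlen : C.length = 2 * h) {u w : V} (hu : u ∉ C) (hw : w ∉ C)
    {x : V} (hux : G.Adj u x) : G.Adj w x := by
  by_contra hwx
  obtain ⟨t, ht, hp⟩ := hC.exists_cons (hC.neighbors_mem hconn hpath h0 hlen hu x hux)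
  have hl := hp.length_eq.trans hlen
  obtain _ | ⟨y, t⟩ := t
  · simp at hl; omega
  rw [← hp.mem_iff] at hu hw
  have hwy : G.Adj w y := by
    by_contra hwy
    exact hwx ((ht.alternates hconn hdeg hcard hpath h0 hl hw).2 hwy)
  have := hpath _ (ht.insert_path hu hw (by rintro rfl; exact hwx hux) hux hwy)
  simp only [List.length_cons, List.length_append, List.length_nil] at this hl
  omega

/-- A cycle on `2 * h` vertices forces a vertex cover with `h` elements. -/
theorem IsCycleList.exists_cover (hconn : G.Connected) (hdeg : ∀ v, h ≤ G.degree v)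
    (hcard : 2 * h + 2 ≤ Fintype.card V)
    (hpath : ∀ l, IsPathList G l → l.length ≤ 2 * h + 1) (h0 : 1 ≤ h)
    (hC : IsCycleList G C) (hlen : C.length = 2 * h) :
    ∃ X : Finset V, X.card = h ∧ ∀ v ∉ X, ∀ y, G.Adj v y → y ∈ X := by
  obtain ⟨w, hw⟩ := length_lt_exists_notMem (l := C) (by omega)
  -- A second outside vertex, for comparison once `w` has been moved onto the cycle.
  obtain ⟨w', hw'⟩ := length_lt_exists_notMem (l := w :: C) (by rw [List.length_cons]; omega)
  rw [List.mem_cons, not_or] at hw'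
  refine ⟨G.neighborFinset w, le_antisymm ?_ (by simpa using hdeg w), fun v hv y hvy => ?_⟩
  · have h1 := degree_le_countP (hC.neighbors_mem hconn hpath h0 hlen hw)
    have h2 := IsCycleList.two_mul_countP_adj_le (s := []) hconn hcard hpath hC hlen hw
    rw [SimpleGraph.card_neighborFinset_eq_degree]
    omega
  rw [SimpleGraph.mem_neighborFinset] at hv ⊢
  by_cases hvC : v ∈ C
  swap
  · exact hC.adj_of_adj hconn hdeg hcard hpath h0 hlen hvC hw hvy
  obtain ⟨t, ht, hp⟩ := hC.exists_cons hvC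
  have hl := hp.length_eq.trans hlen
  rw [← hp.mem_iff] at hw
  rw [← hp.mem_iff] at hw'
  have hnd := List.nodup_cons.1 ht.nodup
  have hwt : w ∉ t := fun h => hw (List.mem_cons_of_mem _ h)
  have hlast : ∀ z ∈ t.getLast?, G.Adj w z := by
    rcases List.eq_nil_or_concat t with rfl | ⟨t', z, rfl⟩
    · simp
    rw [List.concat_eq_append] at *
    have h1 : IsCycleList G (z :: v :: t') := IsCycleList.rotate (s := v :: t') (t := [z]) ht
    have := (h1.alternates (w := w) hconn hdeg hcard hpath h0 (by simpa using hl)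
      (by simp at hw ⊢; tauto)).2 hv
    simpa using this
  -- By alternation `w` sees the cycle neighbours of `v`, so it can take the place of `v`.
  have hC' : IsCycleList G (w :: t) := by
    obtain _ | ⟨z, t⟩ := t
    · simp at hl; omega
    have hwz : G.Adj w z := by
      by_contra hwz
      exact hv ((ht.alternates hconn hdeg hcard hpath h0 hl hw).2 hwz)
    refine ⟨IsPathList.cons (IsPathList.right (s := [v]) ht.toIsPathList) hwt hwz, ?_⟩
    intro a ha b hb
    have hb : w = b := by simpa using hb
    subst hb
    exact (hlast a (by simpa [List.getLast?_cons_cons] using ha)).symm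
  have hv' : v ∉ w :: t := by
    simp only [List.mem_cons, not_or] at hw ⊢
    exact ⟨Ne.symm hw.1, hnd.1⟩
  have hw'' : w' ∉ w :: t := by
    simp only [List.mem_cons, not_or] at hw' ⊢
    exact ⟨hw'.1, hw'.2.2⟩
  -- Now `v` and `w'` are both off the new cycle, so `y` passes from `v` to `w'`; the old cycle then
  -- passes it from `w'` to `w`.
  have := hC'.adj_of_adj hconn hdeg hcard hpath h0 (by simpa using hl) hv' hw'' hvy
  exact hC.adj_of_adj hconn hdeg hcard hpath h0 hlen (by rw [← hp.mem_iff]; exact hw'.2)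
    (by rw [← hp.mem_iff]; exact hw) this

end Cycle
end Finite
-- Crossing edges at the ends of a path
lemma IsCycleList.reverse_append {s t : List V} (hs : IsPathList G s) (ht : IsPathList G t)
    (hst : s.Disjoint t) (hs0 : s ≠ []) (ht0 : t ≠ [])
    (h1 : ∀ x ∈ s.head?, ∀ y ∈ t.head?, G.Adj x y)
    (h2 : ∀ x ∈ s.getLast?, ∀ y ∈ t.getLast?, G.Adj x y) : IsCycleList G (s.reverse ++ t) := by
  refine ⟨hs.reverse.append ht (fun x hx => hst (List.mem_reverse.1 hx)) (by simpa using h1), ?_⟩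
  intro x hx y hy
  rw [List.getLast?_append_of_ne_nil _ ht0] at hx
  rw [List.head?_append_of_ne_nil _ (by simpa using hs0), List.head?_reverse] at hy
  exact (h2 y hy x hx).symm

section Finite

variable [Fintype V] [DecidableRel G.Adj] {h : ℕ}

/-- The alternatives for the neighbours of the first vertex of a path that cannot be lengthened and
whose vertices do not form a cycle. -/
lemma IsPathList.dichotomy (hdeg : ∀ v, h ≤ G.degree v) {m : ℕ} (hm : m ≤ 2 * h)
    (hlong : ∀ l, IsPathList G l → l.length ≠ m + 2)
    (hcyc : ∀ l, IsCycleList G l → l.length ≠ m + 1) {l : List V} (hl : IsPathList G l)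
    (hlen : l.length = m + 1) :
    m = 2 * h ∧ ((∃ C, IsCycleList G C ∧ C.length = m) ∨
      ∀ s c t, l = s ++ c :: t → s.length = h → ∀ x ∈ s.head?, ∀ y, G.Adj x y → y ∈ s ++ [c]) := by
  classical
  obtain ⟨f, hf⟩ : ∃ f : ℕ → V, ∀ i (hi : i < l.length), l[i] = f i := by
    obtain ⟨a, -⟩ := List.exists_mem_of_length_pos (l := l) (by omega)
    exact ⟨fun i => l.getD i a, fun i hi => by simp [hi]⟩
  have hf' : ∀ i, i ≤ m → l[i]? = some (f i) := fun i hi => by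
    rw [List.getElem?_eq_getElem (by omega), hf]
  have hfirst : ∀ y, G.Adj (f 0) y → y ∈ l := fun y hy => by
    by_contra hyl
    obtain _ | ⟨a, l'⟩ := l
    · simp at hlen
    have : a = f 0 := by simpa using hf' 0
    subst this
    exact hlong _ (hl.cons hyl hy.symm) (by simpa using hlen)
  have hlast : ∀ y, G.Adj (f m) y → y ∈ l := fun y hy => by
    by_contra hyl
    refine hlong (l ++ [y]) (hl.append ⟨by simp, by simp⟩ (by simpa using hyl) ?_) (by simp [hlen])
    intro x hx z hz
    rw [List.getLast?_eq_getElem?, hlen, Nat.add_sub_cancel, hf' m le_rfl] at hx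
    obtain rfl : f m = x := by simpa using hx
    obtain rfl : y = z := by simpa using hz
    exact hy
  -- The index in `A` is shifted by one, so a common element of `A` and `B` is a crossing pair of
  -- end edges, which closes the whole path into a cycle.
  set A := (Finset.range m).filter fun i => G.Adj (f 0) (f (i + 1)) with hA
  set B := (Finset.range m).filter fun i => G.Adj (f m) (f i) with hB
  have hfirst' : ∀ y, G.Adj (f 0) y → ∃ i ∈ A, f (i + 1) = y := fun y hy => by
    obtain ⟨j, hj, hjy⟩ := List.getElem_of_mem (hfirst y hy)
    rw [hf] at hjy
    obtain _ | j := j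
    · exact absurd hjy hy.ne
    · exact ⟨j, by simp [hA, hjy, hy]; omega, hjy⟩
  have hcA : h ≤ A.card := by
    refine (hdeg (f 0)).trans ?_
    rw [← SimpleGraph.card_neighborFinset_eq_degree]
    refine (Finset.card_le_card (t := A.image fun i => f (i + 1)) fun y hy => ?_).trans
      Finset.card_image_le
    simpa using hfirst' y (by simpa using hy)
  have hcB : h ≤ B.card := by
    refine (hdeg (f m)).trans ?_
    rw [← SimpleGraph.card_neighborFinset_eq_degree]
    refine (Finset.card_le_card (t := B.image f) fun y hy => ?_).trans Finset.card_image_le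
    have hy : G.Adj (f m) y := by simpa using hy
    obtain ⟨j, hj, hjy⟩ := List.getElem_of_mem (hlast y hy)
    rw [hf] at hjy
    have : j ≠ m := by rintro rfl; exact hy.ne hjy
    exact Finset.mem_image.2 ⟨j, by simp [hB, hjy, hy]; omega, hjy⟩
  have hcross : ∀ i j, i < j → j ≤ m → G.Adj (f 0) (f j) → G.Adj (f m) (f i) →
      IsCycleList G ((l.take (i + 1)).reverse ++ l.drop j) := by
    intro i j hij hjm h1 h2
    have hd : IsPathList G (l.drop j) :=
      IsPathList.right (s := l.take j) (by rwa [List.take_append_drop])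
    have ht : IsPathList G (l.take (i + 1)) :=
      IsPathList.left (t := l.drop (i + 1)) (by rwa [List.take_append_drop])
    refine IsCycleList.reverse_append ht hd ?_ ?_ ?_ ?_ ?_
    · exact List.disjoint_take_drop hl.nodup hij
    · rw [← List.length_pos_iff, List.length_take]; omega
    · rw [← List.length_pos_iff, List.length_drop]; omega
    · intro x hx y hy
      rw [List.head?_take, if_neg (by omega), List.head?_eq_getElem?, hf' 0 (by omega)] at hx
      rw [List.head?_drop, hf' j hjm] at hy
      obtain rfl : f 0 = x := by simpa using hx
      obtain rfl : f j = y := by simpa using hy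
      exact h1
    · intro x hx y hy
      rw [List.getLast?_take, if_neg (by omega), Nat.add_sub_cancel, hf' i (by omega)] at hx
      rw [List.getLast?_drop, if_neg (by omega), List.getLast?_eq_getElem?, hlen,
        Nat.add_sub_cancel, hf' m le_rfl] at hy
      obtain rfl : f i = x := by simpa using hx
      obtain rfl : f m = y := by simpa using hy
      exact h2.symm
  have hAB : Disjoint A B := by
    rw [Finset.disjoint_left]
    intro i hiA hiB
    simp only [hA, hB, Finset.mem_filter, Finset.mem_range] at hiA hiB
    refine hcyc _ (hcross i (i + 1) (by omega) (by omega) hiA.2 hiB.2) ?_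
    simp only [List.length_append, List.length_reverse, List.length_take, List.length_drop, hlen]
    omega
  have hsub : A ∪ B ⊆ Finset.range m :=
    Finset.union_subset (Finset.filter_subset _ _) (Finset.filter_subset _ _)
  have hcard := Finset.card_union_of_disjoint hAB
  have hle := Finset.card_le_card hsub
  rw [Finset.card_range] at hle
  have hm2 : m = 2 * h := by omega
  refine ⟨hm2, or_iff_not_imp_left.2 fun hno => ?_⟩
  have hunion : A ∪ B = Finset.range m :=
    Finset.eq_of_subset_of_card_le hsub (by rw [Finset.card_range]; omega)
  -- If this fails at `i`, the ends are joined to `f (i + 2)` and `f i`, giving a cycle through all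
  -- vertices except `f (i + 1)`.
  have hdown : ∀ i, i + 1 ∈ A → i ∈ A := by
    intro i hi
    by_contra hiA
    simp only [hA, Finset.mem_filter, Finset.mem_range] at hi
    have hiB : i ∈ B := by
      have : i ∈ A ∪ B := by rw [hunion, Finset.mem_range]; omega
      exact (Finset.mem_union.1 this).resolve_left hiA
    simp only [hB, Finset.mem_filter] at hiB
    refine hno ⟨_, hcross i (i + 2) (by omega) (by omega) hi.2 hiB.2, ?_⟩
    simp only [List.length_append, List.length_reverse, List.length_take, List.length_drop, hlen]
    omega
  -- The counts force `A` to have exactly `h` elements, and it is closed downwards.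
  have hAlt : ∀ i ∈ A, i < h := by
    intro i hi
    have hr : Finset.range (i + 1) ⊆ A := by
      intro j hj
      have hj : j ≤ i := by simpa [Nat.lt_succ_iff] using hj
      exact Nat.decreasingInduction (motive := fun j _ => j ∈ A) (fun k _ hk => hdown k hk) hi hj
    have := Finset.card_le_card hr
    rw [Finset.card_range] at this
    omega
  rintro s c t rfl hs x hx y hxy
  have hx0 : x = f 0 := by
    have h1 : (s ++ c :: t).head? = some x := by
      obtain _ | ⟨a, s⟩ := s
      · simp at hx
      · simpa using hx
    rw [List.head?_eq_getElem?, hf' 0 (by omega)] at h1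
    simpa using h1.symm
  subst hx0
  obtain ⟨i, hi, rfl⟩ := hfirst' y hxy
  have hih := hAlt i hi
  have : f (i + 1) = (s ++ [c])[i + 1]'(by simp; omega) := by
    rw [← hf (i + 1) (by rw [hlen]; omega)]
    simp only [show s ++ c :: t = (s ++ [c]) ++ t by simp]
    rw [List.getElem_append_left]
  rw [this]
  exact List.getElem_mem _

/-- While a path has at most `2h` vertices, the degree count closes it into a cycle unless it can be
lengthened, and a cycle opens into a longer path. -/
lemma exists_isPathList (hconn : G.Connected) (hdeg : ∀ v, h ≤ G.degree v)
    (hcard : 2 * h + 2 ≤ Fintype.card V) :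
    ∀ m ≤ 2 * h, ∃ l, IsPathList G l ∧ l.length = m + 1
  | 0, _ => by
    obtain ⟨v⟩ := hconn.nonempty
    exact ⟨[v], ⟨by simp, by simp⟩, rfl⟩
  | m + 1, hm => by
    by_contra! hno
    obtain ⟨l, hl, hlen⟩ := exists_isPathList hconn hdeg hcard m (by omega)
    have := (hl.dichotomy hdeg (by omega) (fun l hl => hno l hl) (fun C hC hlC => ?_) hlen).1
    · omega
    · obtain ⟨l', h1, h2⟩ := hC.exists_longer hconn (by rintro rfl; simp at hlC) (by omega)
      exact hno l' h1 (by omega)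

/-! ### Cliques attached at one vertex -/

/-- The neighbours of each vertex in `s` are `c` and the other vertices in `s`. -/
structure IsBlock (G : SimpleGraph V) (c : V) (s : List V) : Prop where
  nodup : s.Nodup
  notMem : c ∉ s
  adj_iff : ∀ x ∈ s, ∀ y, G.Adj x y ↔ (y = c ∨ y ∈ s) ∧ y ≠ x

/-- The first vertex of each path with `2 * h + 1` vertices has all its neighbours among the
next `h` vertices of the path. -/
def StartsLocally (G : SimpleGraph V) (h : ℕ) : Prop :=
  ∀ s c t, IsPathList G (s ++ c :: t) → s.length = h → t.length = h →
    ∀ x ∈ s.head?, ∀ y, G.Adj x y → y ∈ s ++ [c]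

/-- Only `h` candidates for neighbours remain, and the degree is at least `h`. -/
lemma StartsLocally.adj_iff (hG : StartsLocally G h) (hdeg : ∀ v, h ≤ G.degree v) {s t : List V}
    {c : V} (hp : IsPathList G (s ++ c :: t)) (hs : s.length = h) (ht : t.length = h) {x : V}
    (hx : x ∈ s.head?) (y : V) : G.Adj x y ↔ y ∈ s ++ [c] ∧ y ≠ x := by
  classical
  have hxs : x ∈ s := List.mem_of_mem_head? hx
  have hsub : G.neighborFinset x ⊆ (s ++ [c]).toFinset.erase x := by
    intro y hy
    have hy : G.Adj x y := by simpa using hy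
    rw [Finset.mem_erase, List.mem_toFinset]
    exact ⟨hy.ne', hG s c t hp hs ht x hx y hy⟩
  have hle : ((s ++ [c]).toFinset.erase x).card ≤ (G.neighborFinset x).card := by
    rw [Finset.card_erase_of_mem (by simp [hxs]), SimpleGraph.card_neighborFinset_eq_degree]
    have := List.toFinset_card_le (s ++ [c])
    rw [List.length_append, List.length_singleton] at this
    have := hdeg x
    omega
  have := Finset.ext_iff.1 (Finset.eq_of_subset_of_card_le hsub hle) y
  rw [SimpleGraph.mem_neighborFinset, Finset.mem_erase, List.mem_toFinset] at this
  rw [this, and_comm]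

/-- The first vertex is adjacent to the successor of `x`, so reversing the segment that ends at `x`
gives a path starting at `x` with the same first `h` vertices and the same `c`. -/
lemma StartsLocally.isBlock (hG : StartsLocally G h) (hdeg : ∀ v, h ≤ G.degree v) {s t : List V}
    {c : V} (hp : IsPathList G (s ++ c :: t)) (hs : s.length = h) (ht : t.length = h) :
    IsBlock G c s := by
  refine ⟨hp.left.nodup, fun hc => hp.disjoint hc (by simp), fun x hx y => ?_⟩
  obtain ⟨s₁, s₂, rfl⟩ := List.append_of_mem hx
  have hp' : IsPathList G ((s₁ ++ [x]) ++ (s₂ ++ c :: t)) := by simpa using hp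
  have hnew : IsPathList G ((s₁ ++ [x]).reverse ++ (s₂ ++ c :: t)) := by
    refine hp'.left.reverse.append hp'.right
      (fun z hz => hp'.disjoint (List.mem_reverse.1 hz)) fun a ha b hb => ?_
    rw [List.getLast?_reverse] at ha
    have ha' : a ∈ (s₁ ++ x :: s₂).head? := by cases s₁ <;> simpa using ha
    rw [hG.adj_iff hdeg hp hs ht ha']
    have hb1 : b ∈ s₂ ++ [c] := by cases s₂ <;> simp at hb <;> simp [hb]
    refine ⟨?_, ?_⟩
    · simp only [List.mem_append, List.mem_cons] at hb1 ⊢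
      tauto
    · rintro rfl
      exact hp'.disjoint (List.mem_of_mem_head? ha) (List.mem_of_mem_head? hb)
  have := hG.adj_iff hdeg (s := (s₁ ++ [x]).reverse ++ s₂) (c := c) (t := t) (x := x)
    (by simpa using hnew) (by simp at hs ⊢; omega) ht (by simp) y
  rw [this]
  simp only [List.mem_append, List.mem_cons, List.mem_reverse, List.not_mem_nil, or_false]
  tauto

/-- Greedy extension at the head: `c` and the earlier vertices number fewer than `h`, so a new
neighbour exists, and it cannot lie in `s` because edges leave `s` only through `c`. -/
lemma IsBlock.exists_path {c : V} {s : List V} (hs : IsBlock G c s) (hdeg : ∀ v, h ≤ G.degree v)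
    {y : V} (hyc : y ≠ c) (hys : y ∉ s) :
    ∀ m < h, ∃ z u, IsPathList G (z :: u) ∧ (z :: u).getLast? = some y ∧ u.length = m ∧
      ∀ x ∈ z :: u, x ≠ c ∧ x ∉ s
  | 0, _ => ⟨y, [], ⟨by simp, by simp⟩, rfl, rfl, by simp [hyc, hys]⟩
  | m + 1, hm => by
    classical
    obtain ⟨z, u, hp, hlast, hlen, hav⟩ := hs.exists_path hdeg hyc hys m (by omega)
    obtain ⟨w, hzw, hw⟩ : ∃ w, G.Adj z w ∧ w ∉ c :: u := by
      by_contra! hno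
      have hsub : G.neighborFinset z ⊆ (c :: u).toFinset := fun w hw => by
        simpa using hno w (by simpa using hw)
      have h1 := Finset.card_le_card hsub
      have h2 := List.toFinset_card_le (c :: u)
      have := hdeg z
      rw [SimpleGraph.card_neighborFinset_eq_degree] at h1
      rw [List.length_cons] at h2
      omega
    simp only [List.mem_cons, not_or] at hw
    have hz := hav z (by simp)
    refine ⟨w, z :: u, hp.cons ?_ hzw.symm, by simpa using hlast, by simp [hlen], ?_⟩
    · simp only [List.mem_cons, not_or]
      exact ⟨hzw.ne', hw.2⟩
    · intro x hx
      rcases List.mem_cons.1 hx with rfl | hx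
      · refine ⟨hw.1, fun hxs => ?_⟩
        rcases ((hs.adj_iff x hxs z).1 hzw.symm).1 with h | h
        · exact hz.1 h
        · exact hz.2 h
      · exact hav x hx

/-- The vertices already covered are closed under adjacency. For a neighbour `y` of `c` outside `s`,
a greedy path of `h` vertices ending at `y` continues through `c` and back along `s`, so its first
half is a block. -/
lemma StartsLocally.exists_isBlock (hG : StartsLocally G h) (hconn : G.Connected)
    (hdeg : ∀ v, h ≤ G.degree v) (h0 : 1 ≤ h) {s t : List V} {c : V}
    (hp : IsPathList G (s ++ c :: t)) (hs : s.length = h) (ht : t.length = h) (x : V)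
    (hx : x ≠ c) : ∃ s', IsBlock G c s' ∧ s'.length = h ∧ x ∈ s' := by
  refine (mem_of_closed hconn
    (S := {x | x = c ∨ ∃ s', IsBlock G c s' ∧ s'.length = h ∧ x ∈ s'}) (Or.inl rfl)
    (fun a ha y hay => ?_) x).resolve_left hx
  rcases ha with rfl | ⟨s', h1, h2, h3⟩
  swap
  · rcases ((h1.adj_iff a h3 y).1 hay).1 with h | h
    · exact Or.inl h
    · exact Or.inr ⟨s', h1, h2, h⟩
  have hb := hG.isBlock hdeg hp hs ht
  by_cases hys : y ∈ s
  · exact Or.inr ⟨s, hb, hs, hys⟩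
  obtain ⟨z, u, hu, hlast, hlen, hav⟩ := hb.exists_path hdeg hay.ne' hys (h - 1) (by omega)
  have hnew : IsPathList G ((z :: u) ++ a :: s.reverse) := by
    refine hu.append ?_ ?_ ?_
    · have h1 : IsPathList G (s ++ [a]) := IsPathList.left (t := t) (by simpa using hp)
      simpa using h1.reverse
    · intro w hw hw'
      have := hav w hw
      simp only [List.mem_cons, List.mem_reverse] at hw'
      tauto
    · intro b hb d hd
      rw [hlast] at hb
      obtain rfl : y = b := by simpa using hb
      obtain rfl : a = d := by simpa using hd
      exact hay.symm
  exact Or.inr ⟨z :: u, hG.isBlock hdeg hnew (by simp; omega) (by simpa using hs),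
    by simp; omega, List.mem_of_mem_getLast? hlast⟩

end Finite
-- Cutting paths into the components of the forest
lemma IsPathList.adj_getElem {l : List V} (hl : IsPathList G l) {i j : ℕ} (hi : i < l.length)
    (hj : j < l.length) (hij : i + 1 = j) : G.Adj l[i] l[j] := by
  subst hij
  exact List.isChain_iff_getElem.1 hl.chain i hj

lemma evenLinearForest_isContained {k : ℕ} {a : Fin k → ℕ} (L : Fin k → List V)
    (hL : ∀ i, IsPathList G (L i)) (hlen : ∀ i, (L i).length = 2 * a i)
    (hdis : ∀ i j, i ≠ j → (L i).Disjoint (L j)) : (evenLinearForest a).IsContained G := by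
  refine ⟨⟨⟨fun x => (L x.1)[x.2.1]'(by rw [hlen]; exact x.2.2), ?_⟩, ?_⟩⟩
  · rintro _ _ ⟨i, u, v, huv, rfl, rfl⟩
    rcases SimpleGraph.pathGraph_adj.1 huv with h | h
    · exact (hL i).adj_getElem _ _ h
    · exact ((hL i).adj_getElem _ _ h).symm
  · rintro ⟨i, u⟩ ⟨j, v⟩ huv
    have huv : (L i)[u.1]'(by rw [hlen]; exact u.2) = (L j)[v.1]'(by rw [hlen]; exact v.2) := huv
    by_cases hij : i = j
    · subst hij
      have := (hL i).nodup.getElem_inj_iff.1 huv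
      rw [Fin.ext this]
    · have h1 := List.getElem_mem (l := L i) (n := u.1) (by rw [hlen]; exact u.2)
      have h2 := List.getElem_mem (l := L j) (n := v.1) (by rw [hlen]; exact v.2)
      rw [← huv] at h2
      exact (hdis i j hij h1 h2).elim

/-- A path can be cut into disjoint pieces of given lengths. -/
lemma IsPathList.exists_pieces {ι : Type*} [DecidableEq ι] (m : ι → ℕ) (S : Finset ι) :
    ∀ p : List V, IsPathList G p → ∑ i ∈ S, m i ≤ p.length →
      ∃ L : ι → List V, (∀ i ∈ S, IsPathList G (L i) ∧ (L i).length = m i ∧ L i ⊆ p) ∧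
        ∀ i ∈ S, ∀ j ∈ S, i ≠ j → (L i).Disjoint (L j) := by
  induction S using Finset.induction_on with
  | empty => exact fun p _ _ => ⟨fun _ => [], by simp, by simp⟩
  | insert x S hx ih =>
    intro p hp hlen
    rw [Finset.sum_insert hx] at hlen
    rw [← List.take_append_drop (m x) p] at hp
    obtain ⟨L, hL, hdis⟩ := ih (p.drop (m x)) hp.right (by rw [List.length_drop]; omega)
    have hne : ∀ i ∈ S, i ≠ x := fun i hi h => hx (h ▸ hi)
    refine ⟨Function.update L x (p.take (m x)), fun i hi => ?_, fun i hi j hj hij => ?_⟩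
    · rcases Finset.mem_insert.1 hi with rfl | hi
      · rw [Function.update_self]
        exact ⟨hp.left, by rw [List.length_take]; omega, List.take_subset _ _⟩
      · rw [Function.update_of_ne (hne i hi)]
        exact ⟨(hL i hi).1, (hL i hi).2.1, fun z hz => List.drop_subset _ _ ((hL i hi).2.2 hz)⟩
    · rcases Finset.mem_insert.1 hi with rfl | hi' <;>
        rcases Finset.mem_insert.1 hj with rfl | hj'
      · exact absurd rfl hij
      · rw [Function.update_self, Function.update_of_ne (hne j hj')]
        exact fun z hz hz' => hp.disjoint hz ((hL j hj').2.2 hz')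
      · rw [Function.update_self, Function.update_of_ne (hne i hi')]
        exact fun z hz hz' => hp.disjoint hz' ((hL i hi').2.2 hz)
      · rw [Function.update_of_ne (hne i hi'), Function.update_of_ne (hne j hj')]
        exact hdis i hi' j hj' hij

lemma evenLinearForest_isContained_of_path {k : ℕ} {a : Fin k → ℕ} {p : List V}
    (hp : IsPathList G p) (hlen : ∑ i, 2 * a i ≤ p.length) :
    (evenLinearForest a).IsContained G := by
  obtain ⟨L, hL, hdis⟩ := hp.exists_pieces (fun i => 2 * a i) Finset.univ p hlen
  exact evenLinearForest_isContained L (fun i => (hL i (by simp)).1)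
    (fun i => (hL i (by simp)).2.1) fun i j => hdis i (by simp) j (by simp)

lemma evenLinearForest_isContained_of_two_paths {k : ℕ} {a : Fin k → ℕ} {p q : List V} (i₀ : Fin k)
    (hp : IsPathList G p) (hq : IsPathList G q) (hpq : p.Disjoint q)
    (hplen : ∑ i ∈ Finset.univ.erase i₀, 2 * a i ≤ p.length) (hqlen : 2 * a i₀ ≤ q.length) :
    (evenLinearForest a).IsContained G := by
  obtain ⟨L, hL, hdis⟩ := hp.exists_pieces (fun i => 2 * a i) (Finset.univ.erase i₀) p hplen
  have hq' : IsPathList G (q.take (2 * a i₀)) :=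
    IsPathList.left (t := q.drop (2 * a i₀)) (by rwa [List.take_append_drop])
  have hmem : ∀ i, i ≠ i₀ → i ∈ Finset.univ.erase i₀ := fun i hi => by simpa using hi
  have hd : ∀ i, i ≠ i₀ → (L i).Disjoint (q.take (2 * a i₀)) := fun i hi z hz hz' =>
    hpq ((hL i (hmem i hi)).2.2 hz) (List.take_subset _ _ hz')
  refine evenLinearForest_isContained (Function.update L i₀ (q.take (2 * a i₀)))
    (fun i => ?_) (fun i => ?_) fun i j hij => ?_
  · by_cases hi : i = i₀
    · subst hi; rwa [Function.update_self]
    · rw [Function.update_of_ne hi]; exact (hL i (hmem i hi)).1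
  · by_cases hi : i = i₀
    · subst hi; rw [Function.update_self, List.length_take]; omega
    · rw [Function.update_of_ne hi]; exact (hL i (hmem i hi)).2.1
  · by_cases hi : i = i₀
    · subst hi
      rw [Function.update_self, Function.update_of_ne hij.symm]
      exact (hd j hij.symm).symm
    · rw [Function.update_of_ne hi]
      by_cases hj : j = i₀
      · subst hj
        rw [Function.update_self]
        exact hd i hi
      · rw [Function.update_of_ne hj]
        exact hdis i (hmem i hi) j (hmem j hj) hij

/-! ### Recognizing the two extremal graphs -/

lemma isContained_graphS [Fintype V] {n h : ℕ} (hcard : Fintype.card V = n) {X : Finset V}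
    (hX : X.card = h) (hcov : ∀ v ∉ X, ∀ y, G.Adj v y → y ∈ X) :
    G.IsContained (graphS n h) := by
  classical
  have e₁ : {v // v ∈ X} ≃ Fin h := Fintype.equivFinOfCardEq (by simpa using hX)
  have e₂ : {v // v ∉ X} ≃ Fin (n - h) := Fintype.equivFinOfCardEq (by
    rw [Fintype.card_subtype_compl, hcard]; simp [hX])
  let e : V ≃ Fin h ⊕ Fin (n - h) :=
    (Equiv.sumCompl fun v => v ∈ X).symm.trans (Equiv.sumCongr e₁ e₂)
  have he₁ : ∀ v (hv : v ∈ X), e v = Sum.inl (e₁ ⟨v, hv⟩) := fun v hv => by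
    simp [e, Equiv.sumCompl_symm_apply_of_pos hv]
  have he₂ : ∀ v (hv : v ∉ X), e v = Sum.inr (e₂ ⟨v, hv⟩) := fun v hv => by
    simp [e, Equiv.sumCompl_symm_apply_of_neg hv]
  refine ⟨⟨⟨e, ?_⟩, e.injective⟩⟩
  intro v y hvy
  by_cases hv : v ∈ X <;> by_cases hy : y ∈ X
  · rw [he₁ v hv, he₁ y hy]
    simp [graphS, join, hvy.ne]
  · rw [he₁ v hv, he₂ y hy]
    simp [graphS, join]
  · rw [he₂ v hv, he₁ y hy]
    simp [graphS, join]
  · exact absurd (hcov v hv y hvy) hy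

lemma graphL_adj_inr {t h : ℕ} (x y : Σ _ : Fin t, Fin h) :
    (graphL t h).Adj (Sum.inr x) (Sum.inr y) ↔ x.1 = y.1 ∧ x ≠ y := by
  have : (graphL t h).Adj (Sum.inr x) (Sum.inr y) ↔
      (copies t (SimpleGraph.completeGraph (Fin h))).Adj x y := by
    simp [graphL, join]
  rw [this]
  constructor
  · rintro ⟨i, u, v, huv, rfl, rfl⟩
    exact ⟨rfl, fun h => huv (by simpa using h)⟩
  · obtain ⟨i, u⟩ := x
    obtain ⟨j, v⟩ := y
    rintro ⟨rfl, hne⟩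
    exact ⟨i, u, v, fun h => hne (by rw [h]), rfl, rfl⟩

/-- A graph all of whose vertices other than `c` lie in blocks of order `h` attached at `c`. -/
lemma exists_iso_graphL [Fintype V] {n h : ℕ} (hcard : Fintype.card V = n) {c : V}
    (hb : ∀ x, x ≠ c → ∃ s, IsBlock G c s ∧ s.length = h ∧ x ∈ s) :
    ∃ t, n = t * h + 1 ∧ Nonempty (G ≃g graphL t h) := by
  classical
  choose! s hs hlen hmem using hb
  -- Each vertex is sent to the vertex set of its block; the fibres are the blocks, so the image
  -- indexes the copies of `K_h`.
  let f : {x // x ≠ c} → Set.range (fun x : {x // x ≠ c} => (s x).toFinset) :=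
    Set.rangeFactorization _
  have hnec : ∀ x, x ≠ c → ∀ y ∈ s x, y ≠ c := fun x hx y hy h => (hs x hx).notMem (h ▸ hy)
  have hadj : ∀ x, x ≠ c → ∀ y, y ≠ c → (G.Adj x y ↔ y ∈ s x ∧ y ≠ x) := fun x hx y hy => by
    rw [(hs x hx).adj_iff x (hmem x hx) y]; simp [hy]
  have hmem_iff : ∀ x, x ≠ c → ∀ y, y ≠ c → (y ∈ s x ↔ (s y).toFinset = (s x).toFinset) := by
    intro x hx y hy
    refine ⟨fun hyx => ?_, fun h => ?_⟩
    · ext z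
      rw [List.mem_toFinset, List.mem_toFinset]
      by_cases hzy : z = y
      · subst hzy; simp [hyx, hmem z hy]
      · have h1 := (hs x hx).adj_iff y hyx z
        have h2 := (hs y hy).adj_iff y (hmem y hy) z
        by_cases hzc : z = c
        · subst hzc; simp [(hs x hx).notMem, (hs y hy).notMem]
        · simp only [hzc, hzy, false_or, ne_eq, not_false_eq_true, and_true] at h1 h2
          rw [← h1, ← h2]
    · have : y ∈ (s y).toFinset := by simpa using hmem y hy
      rw [h] at this
      simpa using this
  have hf : ∀ x y : {x // x ≠ c}, f x = f y ↔ x.1 ∈ s y.1 := fun x y => by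
    rw [hmem_iff y y.2 x x.2, Subtype.ext_iff]; rfl
  have hfib : ∀ A, Fintype.card {x // f x = A} = h := by
    rintro ⟨_, x, rfl⟩
    rw [← hlen x x.2, ← List.toFinset_card_of_nodup (hs x x.2).nodup, ← Fintype.card_coe]
    refine Fintype.card_congr ⟨fun y => ⟨y.1.1, ?_⟩, fun y => ⟨⟨y.1, ?_⟩, ?_⟩, ?_, ?_⟩
    · rw [List.mem_toFinset]; exact (hf y.1 x).1 y.2
    · exact hnec x x.2 _ (List.mem_toFinset.1 y.2)
    · exact (hf ⟨y.1, _⟩ x).2 (List.mem_toFinset.1 y.2)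
    · intro y; rfl
    · intro y; rfl
  let I := Set.range (fun x : {x // x ≠ c} => (s x).toFinset)
  let t := Fintype.card I
  let eI : I ≃ Fin t := Fintype.equivFin I
  let e : {x // x ≠ c} ≃ (Σ _ : Fin t, Fin h) :=
    (Equiv.sigmaFiberEquiv f).symm.trans
      (Equiv.sigmaCongr eI fun A => Fintype.equivFinOfCardEq (hfib A))
  have he : ∀ x, (e x).1 = eI (f x) := fun x => rfl
  let g : Fin 1 ⊕ (Σ _ : Fin t, Fin h) → V := Sum.elim (fun _ => c) fun z => (e.symm z).1
  have hg : Function.Bijective g := by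
    refine ⟨?_, fun v => ?_⟩
    · refine Function.Injective.sumElim (fun i j _ => Subsingleton.elim i j)
        (Subtype.val_injective.comp e.symm.injective) fun _ z => (e.symm z).2.symm
    · by_cases hv : v = c
      · exact ⟨Sum.inl 0, hv.symm⟩
      · exact ⟨Sum.inr (e ⟨v, hv⟩), by simp [g]⟩
  have hc : ∀ x, x ≠ c → G.Adj x c := fun x hx => by
    rw [(hs x hx).adj_iff x (hmem x hx)]; exact ⟨Or.inl rfl, hx.symm⟩
  refine ⟨t, ?_, ⟨RelIso.symm ⟨Equiv.ofBijective g hg, ?_⟩⟩⟩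
  · rw [← hcard, ← Fintype.card_of_bijective hg]
    simp [add_comm]
  · rintro (i | x) (j | y)
    · simp [g, graphL, join, Subsingleton.elim i j]
    · simpa [g, graphL, join] using (hc _ (e.symm y).2).symm
    · simpa [g, graphL, join] using hc _ (e.symm x).2
    · obtain ⟨x, rfl⟩ := e.surjective x
      obtain ⟨y, rfl⟩ := e.surjective y
      rw [graphL_adj_inr, he, he, eI.injective.eq_iff, hf, e.injective.ne_iff]
      simp only [g, Equiv.ofBijective_apply, Sum.elim_inr, Equiv.symm_apply_apply]
      rw [SimpleGraph.adj_comm, hadj y.1 y.2 x.1 x.2, ne_eq, ne_eq, Subtype.ext_iff]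

/-! ### Paths through blocks -/

lemma IsBlock.isPathList {c : V} {s : List V} (hs : IsBlock G c s) : IsPathList G s := by
  refine ⟨List.Pairwise.isChain ?_, hs.nodup⟩
  refine hs.nodup.imp_of_mem fun {a b} ha hb hab => ?_
  exact (hs.adj_iff a ha b).2 ⟨Or.inr hb, hab.symm⟩

/-- A common vertex would be adjacent to `x`, which would force `x` into `t`. -/
lemma IsBlock.disjoint {c x : V} {s t : List V} (hs : IsBlock G c s) (ht : IsBlock G c t)
    (hxs : x ∈ s) (hxt : x ∉ t) : s.Disjoint t := by
  intro y hys hyt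
  have hxy : x ≠ y := by rintro rfl; exact hxt hyt
  have := ((ht.adj_iff y hyt x).1 ((hs.adj_iff y hys x).2 ⟨Or.inr hxs, hxy⟩)).1
  rcases this with rfl | h
  · exact hs.notMem hxs
  · exact hxt h

lemma IsBlock.isPathList_append {c : V} {s t : List V} (hs : IsBlock G c s) (ht : IsBlock G c t)
    (hst : s.Disjoint t) : IsPathList G (s ++ c :: t) := by
  have h1 : IsPathList G (c :: t) := by
    obtain _ | ⟨b, t⟩ := t
    · exact ⟨by simp, by simp⟩
    · exact ht.isPathList.cons ht.notMem
        ((ht.adj_iff b (by simp) c).2 ⟨Or.inl rfl, fun h => ht.notMem (by simp [h])⟩).symm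
  refine hs.isPathList.append h1 ?_ fun a ha b hb => ?_
  · intro z hz hz'
    rcases List.mem_cons.1 hz' with rfl | hz'
    · exact hs.notMem hz
    · exact hst hz hz'
  · obtain rfl : c = b := by simpa using hb
    have has := List.mem_of_mem_getLast? ha
    exact (hs.adj_iff a has c).2 ⟨Or.inl rfl, fun h => hs.notMem (h ▸ has)⟩

end LinearForest

/-! ### Assembling the cases -/

theorem theorem1 {k h n : ℕ} (hk : 2 ≤ k) (a : Fin k → ℕ) (ha : ∀ i, 1 ≤ a i)
    (hh : ∑ i, a i = h + 1)
    {V : Type*} [Fintype V] (G : SimpleGraph V) [DecidableRel G.Adj]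
    (hcard : Fintype.card V = n) (hn : 2 * h + 2 ≤ n)
    (hconn : G.Connected) (hdeg : h ≤ G.minDegree) :
    (LinearForest.evenLinearForest a).IsContained G ∨
      G.IsContained (LinearForest.graphS n h) ∨
      ((∃ b : ℕ, Nonempty (LinearForest.evenLinearForest a ≃g
          LinearForest.copies 2 (SimpleGraph.pathGraph (2 * b)))) ∧
        ∃ t : ℕ, n = t * h + 1 ∧ Nonempty (G ≃g LinearForest.graphL t h)) := by
  open LinearForest in
  by_cases hF : (evenLinearForest a).IsContained G
  · exact Or.inl hF
  have hdeg' : ∀ v, h ≤ G.degree v := fun v => hdeg.trans (G.minDegree_le_degree v)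
  have hsum : ∑ i, 2 * a i = 2 * h + 2 := by rw [← Finset.mul_sum, hh]; ring
  have h0 : 1 ≤ h := by
    have : ∑ _i : Fin k, 1 ≤ ∑ i, a i := Finset.sum_le_sum fun i _ => ha i
    simp at this
    omega
  have hpath : ∀ l, IsPathList G l → l.length ≤ 2 * h + 1 := fun l hl => by
    by_contra hlen
    exact hF (evenLinearForest_isContained_of_path hl (by omega))
  have hV : 2 * h + 2 ≤ Fintype.card V := hcard ▸ hn
  -- For `h = 1` a single edge counts as such a cycle.
  by_cases hC : ∃ C, IsCycleList G C ∧ C.length = 2 * h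
  · obtain ⟨C, hC, hlen⟩ := hC
    obtain ⟨X, hX, hcov⟩ := hC.exists_cover hconn hdeg' hV hpath h0 hlen
    exact Or.inr (Or.inl (isContained_graphS hcard hX hcov))
  refine Or.inr (Or.inr ?_)
  have hlong : ∀ l, IsPathList G l → l.length ≠ 2 * h + 2 := fun l hl => by
    have := hpath l hl
    omega
  have hcyc : ∀ l, IsCycleList G l → l.length ≠ 2 * h + 1 := fun l hl hlen => by
    obtain ⟨l', h1, h2⟩ := hl.exists_longer hconn (by rintro rfl; simp at hlen) (by omega)
    exact hlong l' h1 (by omega)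
  have hG : StartsLocally G h := fun s c t hp hs ht =>
    ((hp.dichotomy hdeg' le_rfl hlong hcyc (by simp; omega)).2.resolve_left hC) s c t rfl hs
  obtain ⟨l, hl, hlen⟩ := exists_isPathList hconn hdeg' hV (2 * h) le_rfl
  obtain ⟨s, c, t, rfl, hs, ht⟩ : ∃ s c t, l = s ++ c :: t ∧ s.length = h ∧ t.length = h :=
    ⟨l.take h, l[h], l.drop (h + 1), by simp, by simp; omega, by simp; omega⟩
  have hblock := hG.exists_isBlock hconn hdeg' h0 hl hs ht
  refine ⟨?_, exists_iso_graphL hcard hblock⟩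
  -- Otherwise component `i` fits into one block, and the rest, of total order at most `2h`, into
  -- the path formed by two others through `c`. The third block exists because `n` exceeds `2h + 1`.
  have hbig : ∀ i, h < 2 * a i := by
    intro i
    by_contra hi
    have hbs := hG.isBlock hdeg' hl hs ht
    have hbt : IsBlock G c t.reverse := hG.isBlock hdeg' (s := t.reverse) (t := s.reverse)
      (by simpa using hl.reverse) (by simpa using ht) (by simpa using hs)
    obtain ⟨w, hw⟩ := length_lt_exists_notMem (l := s ++ c :: t) (by omega)
    simp only [List.mem_append, List.mem_cons, not_or] at hw
    obtain ⟨u, hu, hulen, hwu⟩ := hblock w hw.2.1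
    have hus := hu.disjoint hbs hwu hw.1
    have hut := hu.disjoint hbt hwu (by simpa using hw.2.2)
    refine hF (evenLinearForest_isContained_of_two_paths i (hu.isPathList_append hbs hus)
      hbt.isPathList ?_ ?_ ?_)
    · intro z hz hzt
      rcases List.mem_append.1 hz with hz | hz
      · exact hut hz hzt
      · rcases List.mem_cons.1 hz with rfl | hz
        · exact hbt.notMem hzt
        · exact hl.disjoint hz (List.mem_cons_of_mem _ (List.mem_reverse.1 hzt))
    · have := Finset.add_sum_erase Finset.univ (fun i => 2 * a i) (Finset.mem_univ i)
      have := ha i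
      simp only [List.length_append, List.length_cons] at *
      omega
    · rw [List.length_reverse]; omega
  -- Three components of order at least `h + 1` would exceed the total `2h + 2`.
  have hk2 : k = 2 := by
    have : ∑ _i : Fin k, (h + 1) ≤ ∑ i, 2 * a i := Finset.sum_le_sum fun i _ => hbig i
    rw [hsum, Finset.sum_const, Finset.card_univ, Fintype.card_fin, smul_eq_mul] at this
    by_contra hne
    have : 3 * (h + 1) ≤ k * (h + 1) := Nat.mul_le_mul_right _ (by omega)
    omega
  subst hk2
  rw [Fin.sum_univ_two] at hh
  have h1 := hbig 0
  have h2 := hbig 1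
  have haeq : a = fun _ => a 0 := by
    funext i
    fin_cases i
    · rfl
    · change a 1 = a 0
      omega
  refine ⟨a 0, ?_⟩
  rw [haeq]
  exact ⟨SimpleGraph.Iso.refl⟩
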